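/- Let $d\ge 3$ be an odd integer and let $T_d:\mathbb{R}^2\to\mathbb{R}^2$ be the homeomorphism $$T_d(x,y)=\bigl(y-(x+y)^d,\; y-2(x+y)^d\bigr).$$ Let $p_0=(0,1)$ and $p_1=(0,-1)$; these points form a two-cycle of $T_d$, i.e. $T_d(p_0)=p_1$ and $T_d(p_1)=p_0$. For $j\in\{0,1\}$ let $$W^s_{p_j}=\{z\in\mathbb{R}^2 : T_d^{2k}(z)\to p_j \text{ as } k\to\infty\},\qquad W^u_{p_j}=\{z\in\mathbb{R}^2 : T_d^{-2k}(z)\to p_j \text{ as } k\to\infty\}$$ be the global stable and unstable manifolds of $p_j$ as a fixed point of $T_d^2$. Then the unstable manifold of $p_0$ and the stable manifold of $p_1$ intersect in a heteroclinic point: there is a point $q\in W^u_{p_0}\cap W^s_{p_1}$ with $q\notin\{p_0,p_1\}$. -/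

import Mathlib

open Filter Topology

noncomputable section

/-- For odd `d`, the map `x ↦ x ^ d` is an increasing bijection of `ℝ`. Its inverse is the
real `d`-th root `x ↦ x ^ (1 / d)`, defined on all of `ℝ`. -/
def oddPow (d : ℕ) (hd : Odd d) : ℝ ≃o ℝ :=
  StrictMono.orderIsoOfSurjective (fun x : ℝ => x ^ d) hd.strictMono_pow <| by
    have htop : Tendsto (fun x : ℝ => x ^ d) atTop atTop := tendsto_pow_atTop hd.pos.ne'
    refine (continuous_pow d).surjective htop ?_
    have h : Tendsto (fun x : ℝ => -((-x) ^ d)) atBot atBot :=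
      tendsto_neg_atTop_atBot.comp (htop.comp tendsto_neg_atBot_atTop)
    simpa [hd.neg_pow] using h

/-- The homeomorphism `T_d (x, y) = (y - (x + y) ^ d, y - 2 (x + y) ^ d)` of the plane, together
with its inverse `T_d⁻¹ (x, y) = (-2 x + y + (x - y) ^ (1 / d), 2 x - y)`. -/
def secantMap (d : ℕ) (hd : Odd d) : ℝ × ℝ ≃ₜ ℝ × ℝ where
  toFun z := (z.2 - (z.1 + z.2) ^ d, z.2 - 2 * (z.1 + z.2) ^ d)
  invFun z := (-2 * z.1 + z.2 + (oddPow d hd).symm (z.1 - z.2), 2 * z.1 - z.2)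
  left_inv z := by
    have h : (oddPow d hd).symm ((z.1 + z.2) ^ d) = z.1 + z.2 :=
      (oddPow d hd).symm_apply_apply (z.1 + z.2)
    ext
    · have e : z.2 - (z.1 + z.2) ^ d - (z.2 - 2 * (z.1 + z.2) ^ d) = (z.1 + z.2) ^ d := by ring
      simp only [e, h]
      ring
    · simp only
      ring
  right_inv z := by
    have h : ((oddPow d hd).symm (z.1 - z.2)) ^ d = z.1 - z.2 :=
      (oddPow d hd).apply_symm_apply (z.1 - z.2)
    have e : -2 * z.1 + z.2 + (oddPow d hd).symm (z.1 - z.2) + (2 * z.1 - z.2)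
        = (oddPow d hd).symm (z.1 - z.2) := by ring
    ext
    · simp only [e, h]
      ring
    · simp only [e, h]
      ring
  continuous_toFun := by fun_prop
  continuous_invFun := by
    have h : Continuous fun z : ℝ × ℝ => (oddPow d hd).symm (z.1 - z.2) :=
      (oddPow d hd).symm.continuous.comp (by fun_prop)
    fun_prop

/-- The second iterate `T_d ^ 2`. -/
def secantMapSq (d : ℕ) (hd : Odd d) : ℝ × ℝ ≃ₜ ℝ × ℝ :=
  (secantMap d hd).trans (secantMap d hd)

/-- The point `p₀ = (0, 1)`. -/
def p₀ : ℝ × ℝ := (0, 1)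

/-- The point `p₁ = (0, -1)`. -/
def p₁ : ℝ × ℝ := (0, -1)

/-- `{p₀, p₁}` is a two-cycle of `T_d`. -/
theorem secantMap_p₀ (d : ℕ) (hd : Odd d) : secantMap d hd p₀ = p₁ := by
  simp only [secantMap, p₀, p₁, Homeomorph.homeomorph_mk_coe, Equiv.coe_fn_mk]
  norm_num

theorem secantMap_p₁ (d : ℕ) (hd : Odd d) : secantMap d hd p₁ = p₀ := by
  simp only [secantMap, p₀, p₁, Homeomorph.homeomorph_mk_coe, Equiv.coe_fn_mk]
  norm_num [hd.neg_one_pow]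

section InvariantManifolds

variable {X : Type*} [PseudoMetricSpace X]

/-- The local stable manifold of size `δ` of a fixed point `p` of `F`: the points whose whole
forward orbit stays in the open ball of radius `δ` around `p`. -/
def localStableManifold (F : X ≃ₜ X) (p : X) (δ : ℝ) : Set X :=
  {z | ∀ k : ℕ, F^[k] z ∈ Metric.ball p δ}

/-- The (global) stable manifold of a fixed point `p` of `F`: the points whose forward orbit
converges to `p`. -/
def stableManifold (F : X ≃ₜ X) (p : X) : Set X :=
  {z | Tendsto (fun k : ℕ => F^[k] z) atTop (𝓝 p)}

/-- The (global) unstable manifold of a fixed point `p` of `F`: the points whose backward orbit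
converges to `p`. -/
def unstableManifold (F : X ≃ₜ X) (p : X) : Set X :=
  {z | Tendsto (fun k : ℕ => F.symm^[k] z) atTop (𝓝 p)}

/-- The stable manifold consists of the points that, for every size `δ > 0`, are obtained from the
local stable manifold of size `δ` by finitely many backward iterations. -/
theorem mem_stableManifold_iff (F : X ≃ₜ X) (p z : X) :
    z ∈ stableManifold F p ↔ ∀ δ > 0, ∃ n : ℕ, F^[n] z ∈ localStableManifold F p δ := by
  simp only [stableManifold, localStableManifold, Set.mem_ofPred_eq, Metric.tendsto_atTop,
    Metric.mem_ball, ← Function.iterate_add_apply]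
  refine forall₂_congr fun δ _ => exists_congr fun n => ⟨fun h k => h _ (by omega), fun h m hm => ?_⟩
  simpa [Nat.sub_add_cancel hm] using h (m - n)

end InvariantManifolds

end

open Filter Topology

/-! Write `r` for the real `d`-th root and put `wₙ = ((-1)ⁿ (xₙ + yₙ)) ^ d` along an orbit. Since `y
- x` is determined by the previous `w`, being an orbit amounts to `3 wₙ = r(wₙ) + r(wₙ₊₁) + wₙ₋₁`.
The right side is increasing in the whole sequence `w`, so Knaster–Tarski yields a solution between
any ordered sub- and supersolution; no hyperbolicity or continuity is needed there. `lowerBarrier`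
forces the limit `1` at `-∞` and `upperBarrier` the limit `-1` at `+∞`; these ends are `p₀` and
`p₁`. -/

/-- Knaster–Tarski between a subsolution `a` and a supersolution `b`. -/
theorem Monotone.exists_fixedPoint_mem_Icc {α : Type*} [ConditionallyCompleteLattice α]
    {f : α → α} (hf : Monotone f) {a b : α} (hab : a ≤ b) (ha : a ≤ f a) (hb : f b ≤ b) :
    ∃ x ∈ Set.Icc a b, f x = x := by
  have : Fact (a ≤ b) := ⟨hab⟩
  let F : Set.Icc a b →o Set.Icc a b :=
    { toFun := fun x => ⟨f x, ha.trans (hf x.2.1), (hf x.2.2).trans hb⟩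
      monotone' := fun x y h => hf h }
  exact ⟨F.lfp, F.lfp.2, congrArg Subtype.val F.map_lfp⟩

/-! ### Estimates for the real `d`-th root -/

section Root

variable {d : ℕ} {hd : Odd d}

theorem oddPow_symm_pow (w : ℝ) : (oddPow d hd).symm w ^ d = w :=
  (oddPow d hd).apply_symm_apply w

theorem le_oddPow_symm {t w : ℝ} : t ≤ (oddPow d hd).symm w ↔ t ^ d ≤ w :=
  (oddPow d hd).le_symm_apply

theorem oddPow_symm_le {t w : ℝ} : (oddPow d hd).symm w ≤ t ↔ w ≤ t ^ d :=
  (oddPow d hd).symm_apply_le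

theorem oddPow_symm_one : (oddPow d hd).symm 1 = 1 :=
  le_antisymm (oddPow_symm_le.2 (by simp)) (le_oddPow_symm.2 (by simp))

theorem oddPow_symm_neg (w : ℝ) : (oddPow d hd).symm (-w) = -(oddPow d hd).symm w := by
  refine hd.strictMono_pow.injective ?_
  simp only [hd.neg_pow, oddPow_symm_pow]

theorem oddPow_symm_le_one {w : ℝ} (hw : w ≤ 1) : (oddPow d hd).symm w ≤ 1 :=
  oddPow_symm_le.2 (by simpa using hw)

/-- On `[1/8, 1]` the root lies above the chord of the cube root. -/
theorem chord_le_oddPow_symm (hd3 : 3 ≤ d) {w : ℝ} (h₁ : 1 / 8 ≤ w) (h₂ : w ≤ 1) :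
    (3 + 4 * w) / 7 ≤ (oddPow d hd).symm w := by
  obtain ⟨t, rfl⟩ : ∃ t, w = (7 * t - 3) / 4 := ⟨(3 + 4 * w) / 7, by ring⟩
  have e : (3 + 4 * ((7 * t - 3) / 4)) / 7 = t := by ring
  rw [e, le_oddPow_symm]
  have h0 : 0 ≤ t := by linarith
  refine (pow_le_pow_of_le_one h0 (by linarith) hd3).trans ?_
  -- The cubic `(7t - 3)/4 - t³` vanishes where the chord meets the cube root, at `t = 1/2` and `t =
  -- 1`; its third root is `-3/2`.
  have : 0 ≤ (1 - t) * (t - 1 / 2) * (t + 3 / 2) :=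
    mul_nonneg (mul_nonneg (by linarith) (by linarith)) (by linarith)
  linarith [show (1 - t) * (t - 1 / 2) * (t + 3 / 2) = (7 * t - 3) / 4 - t ^ 3 by ring]

/-- Exactly the subsolution inequality for `lowerBarrier` at `n = 0`. -/
theorem oddPow_symm_five_eighths_le (hd3 : 3 ≤ d) :
    (oddPow d hd).symm (5 / 8) ≤ (oddPow d hd).symm (1 / 8) + 3 / 8 := by
  obtain rfl | h5 : d = 3 ∨ 5 ≤ d := by
    obtain ⟨k, rfl⟩ := hd
    omega
  · have h₁ : (1 / 2 : ℝ) ≤ (oddPow 3 hd).symm (1 / 8) := le_oddPow_symm.2 (by norm_num)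
    have h₂ : (oddPow 3 hd).symm (5 / 8) ≤ 7 / 8 := oddPow_symm_le.2 (by norm_num)
    linarith
  · have h₁ : (5 / 8 : ℝ) ≤ (oddPow d hd).symm (1 / 8) :=
      le_oddPow_symm.2 <|
        (pow_le_pow_of_le_one (by norm_num) (by norm_num) h5).trans (by norm_num)
    have h₂ : (oddPow d hd).symm (5 / 8) ≤ 1 := oddPow_symm_le_one (by norm_num)
    linarith

end Root

/-! ### Sub- and supersolution -/

section Barriers

/-- The lower barrier for the heteroclinic sequence. -/
noncomputable def lowerBarrier (n : ℤ) : ℝ :=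
  if n ≤ 0 then 1 - 7 / 8 * (7 / 2) ^ n else if n = 1 then -(5 / 8) else -1

/-- The upper barrier for the heteroclinic sequence. -/
noncomputable def upperBarrier (n : ℤ) : ℝ :=
  if n ≤ -1 then 1 else if n = 0 then 5 / 8 else -(1 - 7 / 4 * (1 / 2) ^ n)

theorem lowerBarrier_of_nonpos {n : ℤ} (hn : n ≤ 0) :
    lowerBarrier n = 1 - 7 / 8 * (7 / 2) ^ n := if_pos hn

theorem lowerBarrier_one : lowerBarrier 1 = -(5 / 8) := by simp [lowerBarrier]

theorem lowerBarrier_of_two_le {n : ℤ} (hn : 2 ≤ n) : lowerBarrier n = -1 := by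
  rw [lowerBarrier, if_neg (by omega), if_neg (by omega)]

theorem upperBarrier_of_neg {n : ℤ} (hn : n ≤ -1) : upperBarrier n = 1 := if_pos hn

theorem upperBarrier_zero : upperBarrier 0 = 5 / 8 := by simp [upperBarrier]

theorem upperBarrier_of_pos {n : ℤ} (hn : 1 ≤ n) :
    upperBarrier n = -(1 - 7 / 4 * (1 / 2) ^ n) := by
  rw [upperBarrier, if_neg (by omega), if_neg (by omega)]

theorem zpow_seven_halves_le_one {n : ℤ} (hn : n ≤ 0) : (7 / 2 : ℝ) ^ n ≤ 1 :=
  zpow_le_one_of_nonpos₀ (by norm_num) hn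

theorem zpow_half_le_half {n : ℤ} (hn : 1 ≤ n) : (1 / 2 : ℝ) ^ n ≤ 1 / 2 := by
  simpa using zpow_le_zpow_right_of_le_one₀ (a := (1 / 2 : ℝ)) (by norm_num) (by norm_num) hn

theorem lowerBarrier_le_upperBarrier : lowerBarrier ≤ upperBarrier := by
  intro n
  have h₁ : (0 : ℝ) < (7 / 2) ^ n := by positivity
  have h₂ : (0 : ℝ) < (1 / 2) ^ n := by positivity
  rcases lt_trichotomy n 0 with h | rfl | h
  · rw [lowerBarrier_of_nonpos h.le, upperBarrier_of_neg (by omega)]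
    linarith
  · rw [lowerBarrier_of_nonpos le_rfl, upperBarrier_zero]
    norm_num
  · have := zpow_half_le_half (n := n) h
    rw [upperBarrier_of_pos h]
    obtain rfl | h := (show 1 ≤ n from h).eq_or_lt
    · rw [lowerBarrier_one]
      norm_num
    · rw [lowerBarrier_of_two_le h]
      linarith

variable {d : ℕ} {hd : Odd d}

/-- The chord bound `r(1 - e) ≥ 1 - 4e/7` makes `1 - cλⁿ` a subsolution as soon as `4λ² - 17λ + 7 ≤
0`, which holds for `λ = 7/2` here and `λ = 1/2` in `upperBarrier`. The factor `7/8` gives the value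
`1/8` at `n = 0`, the left end of the chord. -/
theorem lowerBarrier_subsolution (hd3 : 3 ≤ d) (n : ℤ) :
    lowerBarrier n ≤ ((oddPow d hd).symm (lowerBarrier n)
      + (oddPow d hd).symm (lowerBarrier (n + 1)) + lowerBarrier (n - 1)) / 3 := by
  rcases lt_trichotomy n 0 with h | rfl | h
  · rw [lowerBarrier_of_nonpos h.le, lowerBarrier_of_nonpos (show n + 1 ≤ 0 by omega),
      lowerBarrier_of_nonpos (show n - 1 ≤ 0 by omega)]
    have h₁ := zpow_seven_halves_le_one (n := n + 1) (by omega)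
    have h₀ : (0 : ℝ) < (7 / 2) ^ n := by positivity
    rw [zpow_sub_one₀ (by norm_num)]
    rw [zpow_add_one₀ (by norm_num)] at h₁ ⊢
    have c₁ := chord_le_oddPow_symm (hd := hd) hd3 (w := 1 - 7 / 8 * (7 / 2) ^ n)
      (by linarith) (by linarith)
    have c₂ := chord_le_oddPow_symm (hd := hd) hd3 (w := 1 - 7 / 8 * ((7 / 2) ^ n * (7 / 2)))
      (by linarith) (by linarith)
    linarith
  · have := oddPow_symm_five_eighths_le (hd := hd) hd3
    rw [zero_add, zero_sub, lowerBarrier_one, lowerBarrier_of_nonpos le_rfl,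
      lowerBarrier_of_nonpos (show (-1 : ℤ) ≤ 0 by omega), oddPow_symm_neg]
    norm_num at this ⊢
    linarith
  · obtain rfl | h := (show 1 ≤ n from h).eq_or_lt
    · have := oddPow_symm_le_one (hd := hd) (w := 5 / 8) (by norm_num)
      rw [lowerBarrier_one, lowerBarrier_of_two_le (by omega), lowerBarrier_of_nonpos (by omega),
        oddPow_symm_neg, oddPow_symm_neg, oddPow_symm_one]
      norm_num
      linarith
    · have : -1 ≤ lowerBarrier (n - 1) := by
        obtain rfl | h := (show 2 ≤ n from h).eq_or_lt
        · norm_num [lowerBarrier_one]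
        · rw [lowerBarrier_of_two_le (by omega)]
      rw [lowerBarrier_of_two_le h, lowerBarrier_of_two_le (by omega), oddPow_symm_neg,
        oddPow_symm_one]
      linarith

theorem upperBarrier_supersolution (hd3 : 3 ≤ d) (n : ℤ) :
    ((oddPow d hd).symm (upperBarrier n) + (oddPow d hd).symm (upperBarrier (n + 1))
      + upperBarrier (n - 1)) / 3 ≤ upperBarrier n := by
  have h58 := oddPow_symm_le_one (hd := hd) (w := 5 / 8) (by norm_num)
  have h18 := chord_le_oddPow_symm (hd := hd) hd3 (w := 1 / 8) le_rfl (by norm_num)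
  rcases lt_trichotomy n 0 with h | rfl | h
  · have : (oddPow d hd).symm (upperBarrier (n + 1)) ≤ 1 := by
      obtain h | h := (show n + 1 ≤ 0 by omega).eq_or_lt
      · rwa [h, upperBarrier_zero]
      · rw [upperBarrier_of_neg (by omega), oddPow_symm_one]
    rw [upperBarrier_of_neg (n := n) (by omega), upperBarrier_of_neg (n := n - 1) (by omega),
      oddPow_symm_one]
    linarith
  · rw [upperBarrier_zero, zero_add, zero_sub, upperBarrier_of_pos le_rfl,
      upperBarrier_of_neg le_rfl, oddPow_symm_neg]
    norm_num at h18 h58 ⊢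
    linarith
  · obtain rfl | h := (show 1 ≤ n from h).eq_or_lt
    · have h916 := chord_le_oddPow_symm (hd := hd) hd3 (w := 9 / 16) (by norm_num) (by norm_num)
      rw [upperBarrier_of_pos le_rfl, upperBarrier_of_pos (by omega), sub_self, upperBarrier_zero,
        oddPow_symm_neg, oddPow_symm_neg]
      norm_num at h18 h916 ⊢
      linarith
    · have h₁ := zpow_half_le_half (n := n) (by omega)
      have h₀ : (0 : ℝ) < (1 / 2) ^ n := by positivity
      rw [upperBarrier_of_pos (by omega), upperBarrier_of_pos (n := n + 1) (by omega),
        upperBarrier_of_pos (n := n - 1) (by omega), oddPow_symm_neg, oddPow_symm_neg,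
        zpow_sub_one₀ (by norm_num), zpow_add_one₀ (by norm_num)]
      have c₁ := chord_le_oddPow_symm (hd := hd) hd3 (w := 1 - 7 / 4 * (1 / 2) ^ n)
        (by linarith) (by linarith)
      have c₂ := chord_le_oddPow_symm (hd := hd) hd3 (w := 1 - 7 / 4 * ((1 / 2) ^ n * (1 / 2)))
        (by linarith) (by linarith)
      linarith

theorem tendsto_lowerBarrier_neg :
    Tendsto (fun m : ℕ => lowerBarrier (-m)) atTop (𝓝 1) := by
  have h := tendsto_pow_atTop_nhds_zero_of_lt_one (r := (2 / 7 : ℝ)) (by norm_num) (by norm_num)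
  refine Tendsto.congr (fun m => ?_) (by simpa using (h.const_mul (7 / 8)).const_sub 1)
  rw [lowerBarrier_of_nonpos (by omega), zpow_neg, zpow_natCast, ← inv_pow]
  norm_num

theorem tendsto_upperBarrier :
    Tendsto (fun m : ℕ => upperBarrier m) atTop (𝓝 (-1)) := by
  have h := tendsto_pow_atTop_nhds_zero_of_lt_one (r := (1 / 2 : ℝ)) (by norm_num) (by norm_num)
  have h' : Tendsto (fun m : ℕ => -(1 - 7 / 4 * (1 / 2 : ℝ) ^ m)) atTop (𝓝 (-1)) := by
    simpa using ((h.const_mul (7 / 4)).const_sub 1).neg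
  refine h'.congr' ?_
  filter_upwards [eventually_ge_atTop 1] with m hm
  rw [upperBarrier_of_pos (by omega), zpow_natCast]

end Barriers

/-- The recurrence satisfied by the numbers `((-1) ^ n * (xₙ + yₙ)) ^ d` along an orbit
`(xₙ, yₙ)` of `T_d` has a solution going from `1` at `-∞` to `-1` at `+∞`. -/
theorem exists_heteroclinic_sequence {d : ℕ} (hd : Odd d) (hd3 : 3 ≤ d) :
    ∃ w : ℤ → ℝ,
      (∀ n, (oddPow d hd).symm (w (n + 1)) = 3 * w n - w (n - 1) - (oddPow d hd).symm (w n)) ∧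
      Tendsto w atBot (𝓝 1) ∧ Tendsto w atTop (𝓝 (-1)) ∧ |w 0| < 1 := by
  let Φ : (ℤ → ℝ) → ℤ → ℝ := fun w n =>
    ((oddPow d hd).symm (w n) + (oddPow d hd).symm (w (n + 1)) + w (n - 1)) / 3
  have hΦ : Monotone Φ := fun v w h n => by
    have h₁ := (oddPow d hd).symm.monotone (h n)
    have h₂ := (oddPow d hd).symm.monotone (h (n + 1))
    have h₃ := h (n - 1)
    simp only [Φ]
    linarith
  obtain ⟨w, ⟨hl, hu⟩, hw⟩ := hΦ.exists_fixedPoint_mem_Icc lowerBarrier_le_upperBarrier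
    (lowerBarrier_subsolution hd3) (upperBarrier_supersolution hd3)
  refine ⟨w, fun n => ?_, ?_, ?_, ?_⟩
  · have := congrFun hw n
    simp only [Φ] at this
    linarith
  · rw [← map_neg_atTop, tendsto_map'_iff, ← Nat.map_cast_int_atTop, tendsto_map'_iff]
    refine tendsto_of_tendsto_of_tendsto_of_le_of_le' tendsto_lowerBarrier_neg
      tendsto_const_nhds (.of_forall fun m => hl _) ?_
    filter_upwards [eventually_ge_atTop 1] with m hm
    exact (hu _).trans_eq (upperBarrier_of_neg (by omega))
  · rw [← Nat.map_cast_int_atTop, tendsto_map'_iff]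
    refine tendsto_of_tendsto_of_tendsto_of_le_of_le' tendsto_const_nhds tendsto_upperBarrier
      ?_ (.of_forall fun m => hu _)
    filter_upwards [eventually_ge_atTop 2] with m hm
    exact (lowerBarrier_of_two_le (by omega)).ge.trans (hl _)
  · have h₁ := hl 0
    have h₂ := hu 0
    rw [lowerBarrier_of_nonpos le_rfl] at h₁
    rw [upperBarrier_zero] at h₂
    norm_num at h₁
    rw [abs_lt]
    constructor <;> linarith

/-! ### From the sequence to the orbit -/

/-- The point of the plane with `x + y = w₁ ^ (1 / d)` and `y - x = w₀`. -/
noncomputable def orbitPoint (d : ℕ) (hd : Odd d) (w₀ w₁ : ℝ) : ℝ × ℝ :=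
  (((oddPow d hd).symm w₁ - w₀) / 2, ((oddPow d hd).symm w₁ + w₀) / 2)

theorem tendsto_orbitPoint (d : ℕ) (hd : Odd d) {ι : Type*} {l : Filter ι} {u v : ι → ℝ}
    {a b : ℝ} (hu : Tendsto u l (𝓝 a)) (hv : Tendsto v l (𝓝 b)) :
    Tendsto (fun i => orbitPoint d hd (u i) (v i)) l (𝓝 (orbitPoint d hd a b)) := by
  have h := ((oddPow d hd).symm.continuous.tendsto b).comp hv
  exact ((h.sub hu).div_const 2).prodMk_nhds ((h.add hu).div_const 2)

theorem orbitPoint_one (d : ℕ) (hd : Odd d) : orbitPoint d hd 1 1 = p₀ := by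
  simp [orbitPoint, p₀, oddPow_symm_one]

theorem orbitPoint_neg_one (d : ℕ) (hd : Odd d) : orbitPoint d hd (-1) (-1) = p₁ := by
  norm_num [orbitPoint, p₁, oddPow_symm_neg, oddPow_symm_one]

theorem secantMap_neg (d : ℕ) (hd : Odd d) (z : ℝ × ℝ) :
    secantMap d hd (-z) = -secantMap d hd z := by
  have h : (-z.1 + -z.2) ^ d = -(z.1 + z.2) ^ d := by rw [← neg_add, hd.neg_pow]
  ext
  · simp only [secantMap, Homeomorph.homeomorph_mk_coe, Equiv.coe_fn_mk, Prod.fst_neg,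
      Prod.snd_neg, h]
    ring
  · simp only [secantMap, Homeomorph.homeomorph_mk_coe, Equiv.coe_fn_mk, Prod.fst_neg,
      Prod.snd_neg, h]
    ring

/-- The minus sign is the factor `(-1)ⁿ` in `wₙ`; as the map is odd, it cancels in the second
iterate. -/
theorem secantMap_orbitPoint {d : ℕ} {hd : Odd d} {w₀ w₁ w₂ : ℝ}
    (h : (oddPow d hd).symm w₂ = 3 * w₁ - w₀ - (oddPow d hd).symm w₁) :
    secantMap d hd (orbitPoint d hd w₀ w₁) = -orbitPoint d hd w₁ w₂ := by
  have e : ((oddPow d hd).symm w₁ - w₀) / 2 + ((oddPow d hd).symm w₁ + w₀) / 2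
      = (oddPow d hd).symm w₁ := by ring
  ext
  · simp only [secantMap, orbitPoint, Homeomorph.homeomorph_mk_coe, Equiv.coe_fn_mk, e,
      oddPow_symm_pow, h, Prod.fst_neg]
    ring
  · simp only [secantMap, orbitPoint, Homeomorph.homeomorph_mk_coe, Equiv.coe_fn_mk, e,
      oddPow_symm_pow, h, Prod.snd_neg]
    ring

theorem mainTheorem2 (d : ℕ) (hd : Odd d) (hd3 : 3 ≤ d) :
    ∃ q : ℝ × ℝ,
      q ∈ unstableManifold (secantMapSq d hd) p₀ ∧
      q ∈ stableManifold (secantMapSq d hd) p₁ ∧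
      q ≠ p₀ ∧ q ≠ p₁ := by
  obtain ⟨w, hw, hbot, htop, hw0⟩ := exists_heteroclinic_sequence hd hd3
  let Q : ℤ → ℝ × ℝ := fun n => orbitPoint d hd (w (n - 1)) (w n)
  have hT (n : ℤ) : secantMap d hd (Q n) = -Q (n + 1) := by
    simpa [Q] using secantMap_orbitPoint (hw n)
  have hF (n : ℤ) : secantMapSq d hd (Q n) = Q (n + 2) := by
    rw [secantMapSq, Homeomorph.trans_apply, hT, secantMap_neg, hT, neg_neg, add_assoc,
      one_add_one_eq_two]
  have hF' (n : ℤ) : (secantMapSq d hd).symm (Q n) = Q (n - 2) := by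
    rw [Homeomorph.symm_apply_eq, hF, sub_add_cancel]
  have hfwd (k : ℕ) : (secantMapSq d hd)^[k] (Q 0) = Q (2 * k) := by
    induction k with
    | zero => simp
    | succ k ih =>
      rw [Function.iterate_succ_apply', ih, hF]
      push_cast
      ring_nf
  have hbwd (k : ℕ) : (secantMapSq d hd).symm^[k] (Q 0) = Q (-(2 * k)) := by
    induction k with
    | zero => simp
    | succ k ih =>
      rw [Function.iterate_succ_apply', ih, hF']
      push_cast
      ring_nf
  have hQbot : Tendsto Q atBot (𝓝 p₀) := by
    rw [← orbitPoint_one d hd]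
    refine tendsto_orbitPoint d hd (Tendsto.comp hbot ?_) hbot
    simpa only [sub_eq_add_neg, id] using tendsto_atBot_add_const_right atBot (-1 : ℤ) tendsto_id
  have hQtop : Tendsto Q atTop (𝓝 p₁) := by
    rw [← orbitPoint_neg_one d hd]
    refine tendsto_orbitPoint d hd (Tendsto.comp htop ?_) htop
    simpa only [sub_eq_add_neg, id] using tendsto_atTop_add_const_right atTop (-1 : ℤ) tendsto_id
  have h2 : Tendsto (fun k : ℕ => 2 * (k : ℤ)) atTop atTop :=
    tendsto_natCast_atTop_atTop.const_mul_atTop' (by norm_num)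
  have hsum : (Q 0).1 + (Q 0).2 = (oddPow d hd).symm (w 0) := by
    simp only [Q, orbitPoint]
    ring
  -- `(x + y) ^ d` is `±1` on the two-cycle, whereas `|w 0| < 1`.
  have hpow : ((Q 0).1 + (Q 0).2) ^ d = w 0 := by rw [hsum, oddPow_symm_pow]
  refine ⟨Q 0, ?_, ?_, fun h => ?_, fun h => ?_⟩
  · simp only [unstableManifold, Set.mem_ofPred_eq, hbwd]
    exact hQbot.comp (tendsto_neg_atTop_atBot.comp h2)
  · simp only [stableManifold, Set.mem_ofPred_eq, hfwd]
    exact hQtop.comp h2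
  · rw [h] at hpow
    simp [p₀, ← hpow] at hw0
  · rw [h] at hpow
    simp [p₁, ← hpow, hd.neg_pow] at hw0
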